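/- Consider a latent dynamical system $x_{t+1}=f(x_t)+\varepsilon_t$, $y_t=g(x_t)$ with $f:\mathbb{R}^d\to\mathbb{R}^d$ bijective, $g:\mathbb{R}^d\to\mathbb{R}^D$ injective (both measurable) and i.i.d. noise $\varepsilon_t\sim\mathcal N(0,\Sigma)$ with $\Sigma$ positive definite. Write $p(\cdot\mid x)=\mathcal N(f(x),\Sigma)$, and let $q>0$ be the probability density of the marginal distribution of the latents; the statements below hold for every positive probability density $q$. For a model $\psi:\mathbb{R}^D\times\mathbb{R}^D\to\mathbb{R}$ the contrastive loss, in the limit of an infinite time series, is $$\mathcal L[\psi]=\int q(x)\Big[-\int \psi(g(x),g(x'))\,p(dx'\mid x)+\log\int q(x')\,e^{\psi(g(x),g(x'))}\,dx'\Big]dx .$$ Contrastive learning without a dynamics model uses the dynamics model $\hat f(x)=x$ (symmetric encoders), i.e. $\psi(y,y')=-\|h(y)-h(y')\|^2-\alpha(y')$ with an encoder $h:\mathbb{R}^D\to\mathbb{R}^d$ and a correction term $\alpha$. An encoder $h$ and a dynamics model $\hat f$ are said to identify the system if $\hat f$ is bijective and there are an invertible matrix $L$ and a vector $b$ such that, for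 all $x$, $h(g(x))=Lx+b$ and $\hat f(x)=Lf(L^{-1}(x-b))+b$. Contrastive learning with $\hat f(x)=x$ cannot identify non-trivial latent dynamics: 1. If $L$ is an invertible matrix and $b$ a vector with $x=Lf(L^{-1}(x-b))+b$ for all $x$, then $f=\mathrm{id}$. 2. If $f\ne\mathrm{id}$, then for no encoder $h$ whatsoever do $h$ and $\hat f=\mathrm{id}$ identify the system. 3. If, for some encoder $h$ and the correction term $\alpha(g(x))=\log q(x)$, the model $\psi(y,y')=-\|h(y)-h(y')\|^2-\alpha(y')$ attains the global minimum of $\mathcal L$ over all measurable $\psi$ with well-defined finite loss, then $f(x)=x$ for almost every $x$, and $f=\mathrm{id}$ if $f$ is continuous. 4. In particular, if $f(x)=Ax$ with $A\neq I$, then no encoder $h$ together with $\hat f=\mathrm{id}$ identifies the system, and no model as in 3 attains the global minimum of $\mathcal L$. -/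

import Mathlib

open MeasureTheory

noncomputable section

/-- Euclidean space `ℝⁿ`. -/
abbrev Euc (n : ℕ) : Type := EuclideanSpace ℝ (Fin n)

/-- A latent dynamical system `x_{t+1} = f(x_t) + ε_t`, `y_t = g(x_t)`, with latents in `ℝᵈ`,
observations in `ℝᴰ`, bijective dynamics `f`, injective mixing `g`, and i.i.d. noise
`ε_t ∼ N(0, Sig)` with non-singular covariance matrix `Sig`. -/
structure LatentSystem (d D : ℕ) where
  /-- the ground-truth dynamics -/
  f : Euc d → Euc d
  f_bijective : Function.Bijective f
  f_measurable : Measurable f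
  /-- the mixing function -/
  g : Euc d → Euc D
  g_injective : Function.Injective g
  g_measurable : Measurable g
  /-- the covariance matrix of the system noise -/
  Sig : Matrix (Fin d) (Fin d) ℝ
  Sig_posDef : Sig.PosDef

namespace LatentSystem

variable {d D : ℕ}

/-- The conditional distribution `p(· | x) = N(f x, Sig)` of the next latent `f x + ε`,
`ε ∼ N(0, Sig)`: the distribution of positive samples. -/
def transition (S : LatentSystem d D) (x : Euc d) : Measure (Euc d) :=
  ProbabilityTheory.multivariateGaussian (S.f x) S.Sig

/-- The contrastive loss of a model `ψ` for the reference point `g x`,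
`-∫ ψ(g x, g x') p(dx'|x) + log ∫ q(x') exp ψ(g x, g x') dx'`,
where `q` is the density of the marginal distribution of the latents. -/
def pointLoss (S : LatentSystem d D) (q : Euc d → ℝ) (ψ : Euc D → Euc D → ℝ)
    (x : Euc d) : ℝ :=
  -(∫ x', ψ (S.g x) (S.g x') ∂(S.transition x)) +
    Real.log (∫ x', q x' * Real.exp (ψ (S.g x) (S.g x')))

/-- The contrastive (InfoNCE) loss in the limit of an infinite time series and infinitely many
negative samples: reference points and negative samples are drawn from the marginal
distribution `q`, positive samples from `p(· | x)`. -/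
def contrastiveLoss (S : LatentSystem d D) (q : Euc d → ℝ) (ψ : Euc D → Euc D → ℝ) : ℝ :=
  ∫ x, q x * S.pointLoss q ψ x

/-- The contrastive loss of the measurable model `ψ` is well defined and finite. -/
structure HasFiniteLoss (S : LatentSystem d D) (q : Euc d → ℝ) (ψ : Euc D → Euc D → ℝ) :
    Prop where
  measurable : Measurable (Function.uncurry ψ)
  positive : ∀ᵐ x, Integrable (fun x' => ψ (S.g x) (S.g x')) (S.transition x)
  negative : ∀ᵐ x, Integrable fun x' => q x' * Real.exp (ψ (S.g x) (S.g x'))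
  total : Integrable fun x => q x * S.pointLoss q ψ x

/-- `ψ` attains the global minimum of the contrastive loss (over all models, not only over
those of a particular parametric form). -/
def AttainsGlobalMinimum (S : LatentSystem d D) (q : Euc d → ℝ) (ψ : Euc D → Euc D → ℝ) :
    Prop :=
  S.HasFiniteLoss q ψ ∧
    ∀ ψ' : Euc D → Euc D → ℝ, S.HasFiniteLoss q ψ' →
      S.contrastiveLoss q ψ ≤ S.contrastiveLoss q ψ'

/-- The identifiability conclusion for an encoder `h` and a dynamics model `fhat`: there is a
bijective affine map `x ↦ L x + b` such that `h (g x) = L x + b` for all latents `x`, the model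
`fhat` is bijective, and `fhat x = L (f (L⁻¹ (x - b))) + b`. -/
def Identifies (S : LatentSystem d D) (h : Euc D → Euc d) (fhat : Euc d → Euc d) : Prop :=
  ∃ (L : Euc d ≃ₗ[ℝ] Euc d) (b : Euc d),
    (∀ x, h (S.g x) = L x + b) ∧
    Function.Bijective fhat ∧
    ∀ x, fhat x = L (S.f (L.symm (x - b))) + b

end LatentSystem

/-- The contrastive model `ψ(y, y') = φ(fhat(h(y)), h(y')) - α(y')` with encoder `h`, dynamics
model `fhat`, correction term `α` and similarity `φ(u, v) = -‖u - v‖²`. -/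
def contrastiveModel {d D : ℕ} (h : Euc D → Euc d) (fhat : Euc d → Euc d) (α : Euc D → ℝ)
    (y y' : Euc D) : ℝ :=
  -‖fhat (h y) - h y'‖ ^ 2 - α y'

end

/-!
Only the third claim has analytic content; the first is the substitution `x = L z + b`, and the
other two reduce to these.

Suppose that `ψ(y, y') = -‖h y - h y'‖² - α y'` with `α (g x) = log (q x)` minimises the loss. The
textbook optimum `log p(x' | x) - log q(x')` need not have finite loss for a general density `q`, so
`ψ` is not compared with it. Instead, `ψ` is perturbed by `t φ`, `0 < t ≤ 1`, with `φ = ±1` opposite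
in sign to the defect `q exp ψ / ∫ q exp ψ - p`: the loss changes from `ℓ` to at most
`ℓ - t ∫ q(x) ‖defect(x, ·)‖₁ dx + t²`, so the defect vanishes almost everywhere
(`LatentSystem.AttainsGlobalMinimum.mul_exp_eq`). Any bounded measurable `φ` on pairs of
latents is a function of the observations because the injective measurable map `g` is a measurable embedding.

With `u = h ∘ g` the result reads `exp (-‖u x - u x'‖²) = Z(x) p(x' | x)` for almost all `x`, `x'`.
The left side is at most `1`. Although `u` may fail to be measurable, separability of its range
implies that for almost every `x` the left side is arbitrarily close to `1` on non-null sets of `x'`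
arbitrarily close to `x` (`ae_forall_measure_nhds_inter_ne_zero`). Since the Gaussian density
`p(· | x)` is continuous, it is maximal at `x`. Its only maximiser is its mean `f x`, hence
`f x = x` (`LatentSystem.AttainsGlobalMinimum.ae_eq_id`).
-/

open ProbabilityTheory

/-! ### Densities of Gaussian measures -/

/-- The standard Gaussian measure has a density proportional to `exp (-‖x‖² / 2)`: the two
measures have the same characteristic function. -/
theorem stdGaussian_eq_withDensity (E : Type*) [NormedAddCommGroup E] [InnerProductSpace ℝ E]
    [FiniteDimensional ℝ E] [MeasurableSpace E] [BorelSpace E] :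
    stdGaussian E = volume.withDensity fun x : E =>
      ENNReal.ofReal ((∫ v : E, Real.exp (-(1 / 2 : ℝ) * ‖v‖ ^ 2))⁻¹ *
        Real.exp (-(1 / 2 : ℝ) * ‖x‖ ^ 2)) := by
  have hhalf : (0 : ℝ) < 1 / 2 := by norm_num
  have hI := GaussianFourier.integral_rexp_neg_mul_sq_norm (V := E) hhalf
  set N : ℝ := ∫ v : E, Real.exp (-(1 / 2 : ℝ) * ‖v‖ ^ 2) with hN
  have hNpos : 0 < N := by rw [hI]; positivity
  have hint : Integrable fun v : E => Real.exp (-(1 / 2 : ℝ) * ‖v‖ ^ 2) :=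
    Integrable.of_integral_ne_zero hNpos.ne'
  have : IsFiniteMeasure (volume.withDensity fun x : E =>
      ENNReal.ofReal (N⁻¹ * Real.exp (-(1 / 2 : ℝ) * ‖x‖ ^ 2))) :=
    isFiniteMeasure_withDensity_ofReal (hint.const_mul _).2
  refine Measure.ext_of_charFun ?_
  ext t
  rw [charFun_stdGaussian, charFun_apply,
    integral_withDensity_eq_integral_toReal_smul (by fun_prop) (by simp)]
  have hC := GaussianFourier.integral_cexp_neg_mul_sq_norm_add (V := E) (b := (1 / 2 : ℂ))
    (by norm_num) Complex.I t
  have hNC := GaussianFourier.integral_cexp_neg_mul_sq_norm (V := E) (b := (1 / 2 : ℂ))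
    (by norm_num)
  have hNC' : (N : ℂ) = (Real.pi / (1 / 2 : ℂ)) ^ (Module.finrank ℝ E / 2 : ℂ) := by
    rw [← hNC, hN, ← integral_complex_ofReal]
    congr 1; ext v; push_cast; rfl
  have hpt : ∀ x : E,
      (ENNReal.ofReal (N⁻¹ * Real.exp (-(1 / 2 : ℝ) * ‖x‖ ^ 2))).toReal •
        Complex.exp ((inner ℝ x t : ℝ) * Complex.I) =
      (N : ℂ)⁻¹ * Complex.exp (-(1 / 2 : ℂ) * (‖x‖ : ℂ) ^ 2 + Complex.I * (inner ℝ t x : ℝ)) := by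
    intro x
    rw [ENNReal.toReal_ofReal (by positivity), Complex.real_smul, Complex.exp_add,
      real_inner_comm]
    push_cast
    ring_nf
  simp_rw [hpt]
  rw [integral_const_mul, hC, ← hNC', ← mul_assoc, inv_mul_cancel₀ (by exact_mod_cast hNpos.ne'),
    one_mul, Complex.I_sq]
  ring_nf

theorem map_withDensity_const_add_linearEquiv {d : ℕ} (T : Euc d ≃L[ℝ] Euc d) (m : Euc d)
    {ρ : Euc d → ℝ} (hρ : Measurable ρ) :
    (volume.withDensity fun x => ENNReal.ofReal (ρ x)).map (fun x => m + T x) =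
      volume.withDensity fun x => ENNReal.ofReal
        (|(LinearMap.det (T : Euc d →ₗ[ℝ] Euc d))⁻¹| * ρ (T.symm (x - m))) := by
  have hdet : LinearMap.det (T : Euc d →ₗ[ℝ] Euc d) ≠ 0 :=
    (LinearEquiv.isUnit_det' T.toLinearEquiv).ne_zero
  have hvol : (volume : Measure (Euc d)).map (fun x => m + T x) =
      ENNReal.ofReal |(LinearMap.det (T : Euc d →ₗ[ℝ] Euc d))⁻¹| • volume := by
    have h1 : (volume : Measure (Euc d)).map T =
        ENNReal.ofReal |(LinearMap.det (T : Euc d →ₗ[ℝ] Euc d))⁻¹| • volume :=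
      Measure.map_linearMap_addHaar_eq_smul_addHaar (volume : Measure (Euc d)) hdet
    have h2 : (fun x => m + T x) = (fun x => m + x) ∘ T := rfl
    rw [h2, ← Measure.map_map (measurable_const_add m) T.continuous.measurable, h1, Measure.map_smul,
      map_add_left_eq_self]
  have hmeas : Measurable fun x => m + T x := by fun_prop
  ext s hs
  rw [Measure.map_apply hmeas hs, withDensity_apply _ (hmeas hs), withDensity_apply _ hs]
  have h3 : (fun x => ENNReal.ofReal (ρ x)) =
      fun x => (fun y => ENNReal.ofReal (ρ (T.symm (y - m)))) (m + T x) := by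
    ext x; simp
  have hρm : Measurable fun y : Euc d => ENNReal.ofReal (ρ (T.symm (y - m))) := by fun_prop
  rw [h3, ← setLIntegral_map hs hρm hmeas, hvol, Measure.restrict_smul, lintegral_smul_measure]
  simp_rw [ENNReal.ofReal_mul (abs_nonneg _)]
  rw [lintegral_const_mul _ hρm, smul_eq_mul]

open scoped MatrixOrder in
/-- A Gaussian measure with positive definite covariance matrix has a density, the translate by
the mean of a positive function which is maximal only at the origin. -/
theorem exists_multivariateGaussian_eq_withDensity {d : ℕ} {A : Matrix (Fin d) (Fin d) ℝ}
    (hA : A.PosDef) :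
    ∃ k : Euc d → ℝ, Continuous k ∧ (∀ z, 0 < k z) ∧ (∀ z, k 0 ≤ k z → z = 0) ∧
      ∀ m, multivariateGaussian m A =
        volume.withDensity fun x => ENNReal.ofReal (k (x - m)) := by
  have hunit : IsUnit (Matrix.toEuclideanCLM (n := Fin d) (𝕜 := ℝ) (CFC.sqrt A)) :=
    ((CFC.isUnit_sqrt_iff A hA.posSemidef.nonneg).2 hA.isUnit).map _
  obtain ⟨T, hT⟩ : ∃ T : Euc d ≃L[ℝ] Euc d,
      (T : Euc d →L[ℝ] Euc d) = Matrix.toEuclideanCLM (n := Fin d) (𝕜 := ℝ) (CFC.sqrt A) :=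
    ContinuousLinearMap.isUnit_iff_bijective.1 hunit |> fun h =>
      ⟨ContinuousLinearEquiv.ofBijective _ (LinearMap.ker_eq_bot.2 h.1)
        (LinearMap.range_eq_top.2 h.2), by ext; simp⟩
  have hhalf : (0 : ℝ) < 1 / 2 := by norm_num
  have hN : (0 : ℝ) < (∫ v : Euc d, Real.exp (-(1 / 2 : ℝ) * ‖v‖ ^ 2))⁻¹ := by
    rw [GaussianFourier.integral_rexp_neg_mul_sq_norm hhalf]; positivity
  have hdet : LinearMap.det (T : Euc d →ₗ[ℝ] Euc d) ≠ 0 :=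
    (LinearEquiv.isUnit_det' T.toLinearEquiv).ne_zero
  have hdet' : 0 < |(LinearMap.det (T : Euc d →ₗ[ℝ] Euc d))⁻¹| := abs_pos.2 (inv_ne_zero hdet)
  refine ⟨fun z => |(LinearMap.det (T : Euc d →ₗ[ℝ] Euc d))⁻¹| *
    ((∫ v : Euc d, Real.exp (-(1 / 2 : ℝ) * ‖v‖ ^ 2))⁻¹ *
      Real.exp (-(1 / 2 : ℝ) * ‖T.symm z‖ ^ 2)), by fun_prop, fun z => by positivity, ?_, ?_⟩
  · intro z hz
    have h1 := le_of_mul_le_mul_left (le_of_mul_le_mul_left hz hdet') hN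
    have h2 : ‖T.symm z‖ ^ 2 ≤ 0 := by
      have := Real.exp_le_exp.1 h1
      simp only [map_zero, norm_zero] at this
      linarith
    simpa using h2
  · intro m
    rw [multivariateGaussian, stdGaussian_eq_withDensity, ← hT]
    exact map_withDensity_const_add_linearEquiv T m (by fun_prop)

/-! ### Approximate continuity of arbitrary maps -/

/-- For an arbitrary map `u` into a separable space, measurable or not, almost every point `x` is
such that `u` takes values arbitrarily close to `u x` on a non-null set of points arbitrarily close
to `x`. -/
theorem ae_forall_measure_nhds_inter_ne_zero {X Y : Type*} [TopologicalSpace X]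
    [SecondCountableTopology X] [MeasurableSpace X] (μ : Measure X) [PseudoMetricSpace Y]
    [SecondCountableTopology Y] (u : X → Y) :
    ∀ᵐ x ∂μ, ∀ V ∈ nhds x, ∀ δ > 0, μ (V ∩ {x' | dist (u x') (u x) < δ}) ≠ 0 := by
  -- In the topology induced by `x ↦ (x, u x)`, which is second countable, the points with a null
  -- neighbourhood form a null set.
  let Φ : X → X × Y := fun x => (x, u x)
  have h2 : @SecondCountableTopology X (TopologicalSpace.induced Φ inferInstance) :=
    TopologicalSpace.secondCountableTopology_induced X (X × Y) Φ
  have key := @measure_null_of_locally_null X (Measure X) _ _ μ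
    (TopologicalSpace.induced Φ inferInstance) h2
    {x | ∃ V ∈ nhds x, ∃ δ > 0, μ (V ∩ {x' | dist (u x') (u x) < δ}) = 0} (by
      rintro x ⟨V, hV, δ, hδ, h0⟩
      refine ⟨_, @mem_nhdsWithin_of_mem_nhds X (TopologicalSpace.induced Φ inferInstance) _ _ _ ?_,
        h0⟩
      rw [nhds_induced]
      refine ⟨V ×ˢ Metric.ball (u x) δ, prod_mem_nhds hV (Metric.ball_mem_nhds _ hδ), ?_⟩
      rintro y ⟨hy1, hy2⟩
      exact ⟨hy1, hy2⟩)
  rw [ae_iff]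
  convert key using 2
  ext x
  simp

/-! ### Bounded perturbations of a log-partition function -/

section LogIntegral

variable {X : Type*} [MeasurableSpace X] {μ : Measure X} {w φ : X → ℝ} {t : ℝ}

theorem integrable_mul_exp_of_abs_le (hwi : Integrable w μ) (hφ : Measurable φ)
    (hφ1 : ∀ x, |φ x| ≤ 1) (ht : 0 ≤ t) : Integrable (fun x => w x * Real.exp (t * φ x)) μ := by
  refine hwi.mul_bdd (c := Real.exp t) (by fun_prop) (ae_of_all _ fun x => ?_)
  rw [Real.norm_eq_abs, Real.abs_exp]
  exact Real.exp_le_exp.2 (mul_le_of_le_one_right ht (abs_le.1 (hφ1 x)).2)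

theorem sub_le_log_integral_mul_exp (hw : ∀ x, 0 ≤ w x) (hwi : Integrable w μ)
    (hZ : 0 < ∫ x, w x ∂μ) (hφ : Measurable φ) (hφ1 : ∀ x, |φ x| ≤ 1) (ht : 0 ≤ t) :
    0 < ∫ x, w x * Real.exp (t * φ x) ∂μ ∧
      Real.log (∫ x, w x ∂μ) - t ≤ Real.log (∫ x, w x * Real.exp (t * φ x) ∂μ) := by
  have h1 : (∫ x, w x ∂μ) * Real.exp (-t) ≤ ∫ x, w x * Real.exp (t * φ x) ∂μ := by
    rw [← integral_mul_const]
    refine integral_mono (hwi.mul_const _) (integrable_mul_exp_of_abs_le hwi hφ hφ1 ht)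
      fun x => mul_le_mul_of_nonneg_left (Real.exp_le_exp.2 ?_) (hw x)
    nlinarith [(abs_le.1 (hφ1 x)).1]
  have h2 : 0 < (∫ x, w x ∂μ) * Real.exp (-t) := by positivity
  refine ⟨h2.trans_le h1, ?_⟩
  calc Real.log (∫ x, w x ∂μ) - t = Real.log ((∫ x, w x ∂μ) * Real.exp (-t)) := by
        rw [Real.log_mul hZ.ne' (Real.exp_ne_zero _), Real.log_exp]; ring
    _ ≤ _ := Real.log_le_log h2 h1

/-- Second-order upper bound for a log-partition function under a bounded perturbation of the
energy; the linear term is the mean of the perturbation under the normalised weight. -/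
theorem log_integral_mul_exp_le (hw : ∀ x, 0 ≤ w x) (hwi : Integrable w μ)
    (hZ : 0 < ∫ x, w x ∂μ) (hφ : Measurable φ) (hφ1 : ∀ x, |φ x| ≤ 1) (ht : 0 ≤ t) (ht1 : t ≤ 1) :
    Real.log (∫ x, w x * Real.exp (t * φ x) ∂μ) ≤
      Real.log (∫ x, w x ∂μ) + t * ∫ x, w x / (∫ y, w y ∂μ) * φ x ∂μ + t ^ 2 := by
  set Z := ∫ x, w x ∂μ with hZdef
  have hwφ : Integrable (fun x => w x / Z * φ x) μ :=
    (hwi.div_const Z).mul_bdd (c := 1) hφ.aestronglyMeasurable (ae_of_all _ hφ1)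
  have h1 : ∫ x, w x * Real.exp (t * φ x) ∂μ ≤ Z * (1 + t * ∫ x, w x / Z * φ x ∂μ + t ^ 2) := by
    calc ∫ x, w x * Real.exp (t * φ x) ∂μ
        ≤ ∫ x, ((1 + t ^ 2) * w x + Z * t * (w x / Z * φ x)) ∂μ := by
          refine integral_mono (integrable_mul_exp_of_abs_le hwi hφ hφ1 ht)
            ((hwi.const_mul _).add (hwφ.const_mul _)) fun x => ?_
          have hsq : (t * φ x) ^ 2 ≤ t ^ 2 := by
            rw [mul_pow]
            exact mul_le_of_le_one_right (sq_nonneg t) ((sq_le_one_iff_abs_le_one _).2 (hφ1 x))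
          have habs : |t * φ x| ≤ 1 := by
            rw [abs_mul, abs_of_nonneg ht]
            exact mul_le_one₀ ht1 (abs_nonneg _) (hφ1 x)
          have hexp : Real.exp (t * φ x) ≤ 1 + t * φ x + t ^ 2 := by
            linarith [(abs_le.1 (Real.abs_exp_sub_one_sub_id_le habs)).2]
          calc w x * Real.exp (t * φ x) ≤ w x * (1 + t * φ x + t ^ 2) :=
                mul_le_mul_of_nonneg_left hexp (hw x)
            _ = (1 + t ^ 2) * w x + Z * t * (w x / Z * φ x) := by
                field_simp
                ring
      _ = Z * (1 + t * ∫ x, w x / Z * φ x ∂μ + t ^ 2) := by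
          rw [integral_add (hwi.const_mul _) (hwφ.const_mul _), integral_const_mul,
            integral_const_mul, ← hZdef]
          ring
  have hpos := (sub_le_log_integral_mul_exp hw hwi hZ hφ hφ1 ht).1
  have hpos2 : 0 < 1 + t * ∫ x, w x / Z * φ x ∂μ + t ^ 2 :=
    pos_of_mul_pos_right (hpos.trans_le h1) hZ.le
  calc Real.log (∫ x, w x * Real.exp (t * φ x) ∂μ)
      ≤ Real.log (Z * (1 + t * ∫ x, w x / Z * φ x ∂μ + t ^ 2)) := Real.log_le_log hpos h1
    _ = Real.log Z + Real.log (1 + t * ∫ x, w x / Z * φ x ∂μ + t ^ 2) :=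
        Real.log_mul hZ.ne' hpos2.ne'
    _ ≤ _ := by linarith [Real.log_le_sub_one_of_pos hpos2]

end LogIntegral

/-! ### Minimisers of the contrastive loss -/

namespace LatentSystem

variable {d D : ℕ}

/-- A minimiser of the contrastive loss reproduces the density ratio: up to the normalisation
`∫ q exp ψ`, the function `q exp ψ` is the transition density. The loss of the optimal model may be
infinite, so `ψ` is compared with the bounded perturbations `ψ + t φ` only, where `φ = ±1` is
opposite in sign to the defect. -/
theorem AttainsGlobalMinimum.mul_exp_eq {S : LatentSystem d D} {q : Euc d → ℝ}
    {ψ : Euc D → Euc D → ℝ} (hmin : S.AttainsGlobalMinimum q ψ) (hq_meas : Measurable q)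
    (hq_pos : ∀ x, 0 < q x) (hq_one : ∫ x, q x = 1) {k : Euc d → ℝ} (hk : Measurable k)
    (hk0 : ∀ z, 0 ≤ k z)
    (htrans : ∀ x, S.transition x = volume.withDensity fun x' => ENNReal.ofReal (k (x' - S.f x))) :
    ∀ᵐ x, 0 < (∫ x', q x' * Real.exp (ψ (S.g x) (S.g x'))) ∧
      ∀ᵐ x', q x' * Real.exp (ψ (S.g x) (S.g x')) =
        (∫ x', q x' * Real.exp (ψ (S.g x) (S.g x'))) * k (x' - S.f x) := by
  obtain ⟨hfin, hle⟩ := hmin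
  have hqi : Integrable q := Integrable.of_integral_ne_zero (by rw [hq_one]; exact one_ne_zero)
  have hg : MeasurableEmbedding S.g := S.g_measurable.measurableEmbedding S.g_injective
  have hf := S.f_measurable
  have hgm := S.g_measurable
  have hψ : Measurable fun z : Euc d × Euc d => ψ (S.g z.1) (S.g z.2) :=
    hfin.measurable.comp ((hgm.comp measurable_fst).prodMk (hgm.comp measurable_snd))
  let w : Euc d → Euc d → ℝ := fun x x' => q x' * Real.exp (ψ (S.g x) (S.g x'))
  let Z : Euc d → ℝ := fun x => ∫ x', w x x'
  let p : Euc d → Euc d → ℝ := fun x x' => k (x' - S.f x)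
  have hw_meas : Measurable (Function.uncurry w) := (hq_meas.comp measurable_snd).mul hψ.exp
  have hp_meas : Measurable (Function.uncurry p) :=
    hk.comp (measurable_snd.sub (hf.comp measurable_fst))
  have hZ_meas : Measurable Z := hw_meas.stronglyMeasurable.integral_prod_right.measurable
  have hν_meas : Measurable (Function.uncurry fun x x' => w x x' / Z x) :=
    hw_meas.div (hZ_meas.comp measurable_fst)
  let φ : Euc d → Euc d → ℝ := fun x x' => if p x x' < w x x' / Z x then -1 else 1
  have hφ_meas : Measurable (Function.uncurry φ) :=
    Measurable.ite (measurableSet_lt hp_meas hν_meas) measurable_const measurable_const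
  have hφ1 : ∀ x x', |φ x x'| ≤ 1 := fun x x' => by
    simp only [φ]; split_ifs <;> simp
  let Φ : Euc D × Euc D → ℝ := Function.extend (Prod.map S.g S.g) (Function.uncurry φ) 0
  have hΦ_meas : Measurable Φ := (hg.prodMap hg).measurable_extend hφ_meas measurable_const
  have hΦ : ∀ x x', Φ (S.g x, S.g x') = φ x x' := fun x x' =>
    (hg.prodMap hg).injective.extend_apply (Function.uncurry φ) 0 (x, x')
  let δ : Euc d → ℝ := fun x => ∫ x', |w x x' / Z x - p x x'|
  have hδ_meas : Measurable δ :=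
    (hν_meas.sub hp_meas).abs.stronglyMeasurable.integral_prod_right.measurable
  have hw0 : ∀ x x', 0 < w x x' := fun x x' => mul_pos (hq_pos x') (Real.exp_pos _)
  have hw_int : ∀ᵐ x, Integrable (w x) := hfin.negative
  have hZ : ∀ᵐ x, 0 < Z x := by
    filter_upwards [hw_int] with x hx
    refine (integral_pos_iff_support_of_nonneg (fun x' => (hw0 x x').le) hx).2 ?_
    have : Function.support (w x) = Set.univ := Set.eq_univ_of_forall fun x' => (hw0 x x').ne'
    rw [this]
    exact isOpen_univ.measure_pos volume Set.univ_nonempty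
  have hprob : ∀ x, IsProbabilityMeasure (S.transition x) := fun x => by
    unfold transition; infer_instance
  have hpx : ∀ x, Measurable (p x) := fun x => hp_meas.comp measurable_prodMk_left
  have hp_int : ∀ x, Integrable (p x) := fun x => by
    refine ⟨(hpx x).aestronglyMeasurable,
      (hasFiniteIntegral_iff_ofReal (ae_of_all _ fun x' => hk0 _)).2 ?_⟩
    have h1 := (hprob x).measure_univ
    rw [htrans x, withDensity_apply _ MeasurableSet.univ, Measure.restrict_univ] at h1
    exact h1 ▸ ENNReal.one_lt_top
  have hint_trans : ∀ x (a : Euc d → ℝ), ∫ x', a x' ∂(S.transition x) = ∫ x', p x x' * a x' := by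
    intro x a
    rw [htrans x, integral_withDensity_eq_integral_toReal_smul
      ((hpx x).ennreal_ofReal) (by simp)]
    simp [p, ENNReal.toReal_ofReal, hk0]
  let ψt : ℝ → Euc D → Euc D → ℝ := fun t y y' => ψ y y' + t * Φ (y, y')
  have hφx : ∀ x, Measurable (φ x) := fun x => hφ_meas.comp measurable_prodMk_left
  have hφ_int : ∀ x, Integrable (φ x) (S.transition x) := fun x =>
    Integrable.of_bound (hφx x).aestronglyMeasurable 1 (ae_of_all _ (hφ1 x))
  -- The mean of `φ` under the normalised weight, minus that under the transition
  -- density, is minus the `L¹` distance of the two densities.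
  have hdefect : ∀ x, Integrable (w x) →
      (∫ x', w x x' / Z x * φ x x') - ∫ x', φ x x' ∂(S.transition x) = -δ x := by
    intro x hx
    rw [hint_trans, ← integral_sub ((hx.div_const _).mul_bdd (c := 1)
      (hφx x).aestronglyMeasurable (ae_of_all _ (hφ1 x))) ((hp_int x).mul_bdd (c := 1)
      (hφx x).aestronglyMeasurable (ae_of_all _ (hφ1 x))), ← integral_neg]
    congr 1
    ext x'
    simp only [φ]
    split_ifs with h
    · rw [abs_of_pos (sub_pos.2 h)]; ring
    · rw [abs_of_nonpos (sub_nonpos.2 (not_lt.1 h))]; ring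
  have hexp : ∀ t x x', q x' * Real.exp (ψt t (S.g x) (S.g x')) =
      w x x' * Real.exp (t * φ x x') := fun t x x' => by
    simp only [ψt, hΦ, w, Real.exp_add, mul_assoc]
  have hpoint : ∀ᵐ x, ∀ t, 0 ≤ t → t ≤ 1 →
      S.pointLoss q (ψt t) x ≤ S.pointLoss q ψ x - t * δ x + t ^ 2 ∧
      S.pointLoss q ψ x - 2 * t ≤ S.pointLoss q (ψt t) x := by
    filter_upwards [hfin.positive, hw_int, hZ] with x hx1 hx2 hx3 t ht ht1
    have hlin : ∫ x', ψt t (S.g x) (S.g x') ∂(S.transition x) =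
        ∫ x', ψ (S.g x) (S.g x') ∂(S.transition x) + t * ∫ x', φ x x' ∂(S.transition x) := by
      simp only [ψt, hΦ]
      rw [integral_add hx1 ((hφ_int x).const_mul t), integral_const_mul]
    have hup := log_integral_mul_exp_le (fun x' => (hw0 x x').le) hx2 hx3 (hφx x) (hφ1 x) ht ht1
    have hlo := (sub_le_log_integral_mul_exp (fun x' => (hw0 x x').le) hx2 hx3 (hφx x) (hφ1 x)
      ht).2
    have hφle : ∫ x', φ x x' ∂(S.transition x) ≤ 1 := by
      have := integral_mono (hφ_int x) (integrable_const (1 : ℝ)) fun x' => (abs_le.1 (hφ1 x x')).2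
      simpa using this
    have hd := hdefect x hx2
    simp only [pointLoss, hexp, hlin]
    change _ ≤ -_ + Real.log (∫ x', w x x') - _ + _ ∧ -_ + Real.log (∫ x', w x x') - _ ≤ _
    constructor
    · rw [show δ x = -((∫ x', w x x' / Z x * φ x x') - ∫ x', φ x x' ∂(S.transition x)) by
        rw [hd, neg_neg]]
      linarith
    · nlinarith
  have hδ_nonneg : ∀ x, 0 ≤ δ x := fun x => integral_nonneg fun _ => abs_nonneg _
  have hδ_le : ∀ᵐ x, δ x ≤ 3 := by
    filter_upwards [hpoint] with x hx
    linarith [(hx 1 zero_le_one le_rfl).1, (hx 1 zero_le_one le_rfl).2]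
  have hqδ : Integrable fun x => q x * δ x :=
    hqi.mul_bdd (c := 3) hδ_meas.aestronglyMeasurable (by
      filter_upwards [hδ_le] with x hx
      rwa [Real.norm_of_nonneg (hδ_nonneg x)])
  have hpl_meas : ∀ t, Measurable (S.pointLoss q (ψt t)) := by
    intro t
    have hψt : Measurable fun z : Euc d × Euc d => ψt t (S.g z.1) (S.g z.2) := by
      simp only [ψt, hΦ]
      exact hψ.add (hφ_meas.const_mul t)
    unfold pointLoss
    simp only [hint_trans]
    refine Measurable.add (Measurable.neg ?_) (Measurable.log ?_)
    · exact (hp_meas.mul hψt).stronglyMeasurable.integral_prod_right.measurable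
    · exact ((hq_meas.comp measurable_snd).mul
        hψt.exp).stronglyMeasurable.integral_prod_right.measurable
  have hψt_fin : ∀ t, 0 ≤ t → t ≤ 1 → S.HasFiniteLoss q (ψt t) := by
    intro t ht ht1
    refine ⟨hfin.measurable.add (hΦ_meas.const_mul t), ?_, ?_, ?_⟩
    · filter_upwards [hfin.positive] with x hx
      simp only [ψt, hΦ]
      exact hx.add ((hφ_int x).const_mul t)
    · filter_upwards [hw_int] with x hx
      simp only [hexp]
      exact integrable_mul_exp_of_abs_le hx (hφx x) (hφ1 x) ht
    · refine (hfin.total.norm.add (hqi.const_mul 2)).mono'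
        (hq_meas.mul (hpl_meas t)).aestronglyMeasurable ?_
      filter_upwards [hpoint] with x hx
      have h1 : |S.pointLoss q (ψt t) x| ≤ |S.pointLoss q ψ x| + 2 := by
        have h2 := hx t ht ht1
        have h3 : |S.pointLoss q (ψt t) x - S.pointLoss q ψ x| ≤ 2 := by
          rw [abs_le]; constructor
          · linarith [h2.2]
          · nlinarith [h2.1, hδ_nonneg x]
        linarith [abs_sub_abs_le_abs_sub (S.pointLoss q (ψt t) x) (S.pointLoss q ψ x)]
      simp only [Pi.add_apply, norm_mul, Real.norm_eq_abs, abs_of_pos (hq_pos x)]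
      nlinarith [hq_pos x]
  have hsub_int : ∀ t, Integrable fun x => q x * S.pointLoss q ψ x - t * (q x * δ x) := fun t =>
    hfin.total.sub (hqδ.const_mul t)
  have hstep : ∀ t, 0 < t → t ≤ 1 → ∫ x, q x * δ x ≤ t := by
    intro t ht ht1
    have h1 := hle (ψt t) (hψt_fin t ht.le ht1)
    have h2 : S.contrastiveLoss q (ψt t) ≤
        S.contrastiveLoss q ψ - t * (∫ x, q x * δ x) + t ^ 2 := by
      have h3 : ∫ x, (q x * S.pointLoss q ψ x - t * (q x * δ x) + t ^ 2 * q x) =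
          S.contrastiveLoss q ψ - t * (∫ x, q x * δ x) + t ^ 2 := by
        rw [integral_add (hsub_int t) (hqi.const_mul _),
          integral_sub hfin.total (hqδ.const_mul t), integral_const_mul, integral_const_mul,
          hq_one, mul_one]
        rfl
      rw [← h3]
      refine integral_mono_ae (hψt_fin t ht.le ht1).total
        ((hsub_int t).add (hqi.const_mul _)) ?_
      filter_upwards [hpoint] with x hx
      have := mul_le_mul_of_nonneg_left (hx t ht.le ht1).1 (hq_pos x).le
      linarith
    have h4 : t * (∫ x, q x * δ x) ≤ t * t := by nlinarith
    exact le_of_mul_le_mul_left h4 ht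
  have hzero : ∫ x, q x * δ x = 0 := by
    refine le_antisymm (le_of_forall_pos_le_add fun ε hε => ?_)
      (integral_nonneg fun x => mul_nonneg (hq_pos x).le (hδ_nonneg x))
    have := hstep (min ε 1) (lt_min hε one_pos) (min_le_right _ _)
    linarith [min_le_left ε 1]
  have hae := (integral_eq_zero_iff_of_nonneg
    (fun x => mul_nonneg (hq_pos x).le (hδ_nonneg x)) hqδ).1 hzero
  filter_upwards [hae, hw_int, hZ] with x hx hx2 hx3
  refine ⟨hx3, ?_⟩
  have hδ0 : δ x = 0 := (mul_eq_zero.1 hx).resolve_left (hq_pos x).ne'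
  have h5 := (integral_eq_zero_iff_of_nonneg (fun _ => abs_nonneg _)
    ((hx2.div_const _).sub (hp_int x)).abs).1 hδ0
  filter_upwards [h5] with x' hx'
  have h6 : w x x' / Z x - p x x' = 0 := abs_eq_zero.1 hx'
  have h7 : w x x' = Z x * p x x' := by
    rw [sub_eq_zero, div_eq_iff hx3.ne'] at h6
    rw [h6, mul_comm]
  exact h7

/-- A global minimum with the identity as dynamics model forces almost every `x` to be a maximiser
of its own transition density, hence to be the mean `f x` of the next latent. -/
theorem AttainsGlobalMinimum.ae_eq_id {S : LatentSystem d D} {q : Euc d → ℝ}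
    {h : Euc D → Euc d} {α : Euc D → ℝ} (hα : ∀ x, α (S.g x) = Real.log (q x))
    (hmin : S.AttainsGlobalMinimum q (contrastiveModel h id α)) (hq_meas : Measurable q)
    (hq_pos : ∀ x, 0 < q x) (hq_one : ∫ x, q x = 1) : S.f =ᵐ[volume] id := by
  obtain ⟨k, hk, hk0, hkmax, htrans⟩ := exists_multivariateGaussian_eq_withDensity S.Sig_posDef
  have hdens := hmin.mul_exp_eq hq_meas hq_pos hq_one hk.measurable (fun z => (hk0 z).le)
    fun x => htrans (S.f x)
  let u : Euc d → Euc d := fun x => h (S.g x)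
  have hmodel : ∀ x x', q x' * Real.exp (contrastiveModel h id α (S.g x) (S.g x')) =
      Real.exp (-‖u x - u x'‖ ^ 2) := fun x x' => by
    rw [contrastiveModel, hα, Real.exp_sub, Real.exp_log (hq_pos x'), mul_div_cancel₀ _
      (hq_pos x').ne']
    rfl
  filter_upwards [hdens, ae_forall_measure_nhds_inter_ne_zero volume u] with x ⟨hZ, hx⟩ hnear
  simp only [hmodel] at hZ hx
  set Z := ∫ x', Real.exp (-‖u x - u x'‖ ^ 2)
  have hcont : Continuous fun x' => Z * k (x' - S.f x) := by fun_prop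
  -- `exp (-‖u x - u x'‖²)` is at most `1`, so its continuous version is at most `1` on a dense set
  -- and hence everywhere.
  have hupper : ∀ x', Z * k (x' - S.f x) ≤ 1 := by
    have hdense : Dense {x' | Real.exp (-‖u x - u x'‖ ^ 2) = Z * k (x' - S.f x)} :=
      Measure.dense_of_ae hx
    have hclosed : IsClosed {x' | Z * k (x' - S.f x) ≤ 1} := isClosed_le hcont continuous_const
    have hsub : {x' | Real.exp (-‖u x - u x'‖ ^ 2) = Z * k (x' - S.f x)} ⊆
        {x' | Z * k (x' - S.f x) ≤ 1} := fun x' hx' => by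
      simp only [Set.mem_ofPred_eq] at hx' ⊢
      rw [← hx', Real.exp_le_one_iff]
      linarith [sq_nonneg ‖u x - u x'‖]
    exact fun x' => hclosed.closure_subset_iff.2 hsub (hdense x')
  -- It comes arbitrarily close to `1` near `x`, so its continuous version equals `1` at `x`.
  have hlower : 1 ≤ Z * k (x - S.f x) := by
    by_contra! hlt
    obtain ⟨c, hc1, hc2⟩ := exists_between hlt
    have hV : {x' | Z * k (x' - S.f x) < c} ∈ nhds x :=
      (isOpen_lt hcont continuous_const).mem_nhds hc1
    obtain ⟨δ, hδ, hδc⟩ : ∃ δ > 0, c ≤ Real.exp (-δ ^ 2) := by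
      have h1 : ContinuousAt (fun δ : ℝ => Real.exp (-δ ^ 2)) 0 := by fun_prop
      have h2 : ∀ᶠ δ in nhds (0 : ℝ), c < Real.exp (-δ ^ 2) :=
        h1.eventually (lt_mem_nhds (by simpa using hc2))
      obtain ⟨r, hr, hball⟩ := Metric.eventually_nhds_iff.1 h2
      exact ⟨r / 2, half_pos hr, (hball (by
        rw [Real.dist_eq, sub_zero, abs_of_pos (half_pos hr)]; exact half_lt_self hr)).le⟩
    refine hnear _ hV δ hδ (measure_mono_null (fun x' hx' => ?_) hx)
    obtain ⟨hx1, hx2⟩ := hx'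
    simp only [Set.mem_ofPred_eq] at hx1 hx2
    simp only [Set.mem_compl_iff, Set.mem_ofPred_eq]
    intro heq
    rw [← heq] at hx1
    have : Real.exp (-δ ^ 2) ≤ Real.exp (-‖u x - u x'‖ ^ 2) := by
      rw [Real.exp_le_exp, ← dist_eq_norm, dist_comm]
      have := pow_le_pow_left₀ dist_nonneg hx2.le 2
      linarith
    linarith
  have hmax : k 0 ≤ k (x - S.f x) := by
    have h1 := hupper (S.f x)
    rw [sub_self] at h1
    exact le_of_mul_le_mul_left (h1.trans hlower) hZ
  exact (sub_eq_zero.1 (hkmax _ hmax)).symm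

theorem f_eq_id_of_affine_conj (S : LatentSystem d D) (L : Euc d ≃ₗ[ℝ] Euc d) (b : Euc d)
    (hL : ∀ x, x = L (S.f (L.symm (x - b))) + b) : S.f = id := by
  ext1 z
  have h := hL (L z + b)
  rw [add_sub_cancel_right, L.symm_apply_apply] at h
  exact (L.injective (add_right_cancel h)).symm

theorem not_identifies_id (S : LatentSystem d D) (hS : S.f ≠ id) (h : Euc D → Euc d) :
    ¬ S.Identifies h id := fun ⟨L, b, _, _, hL⟩ => hS (S.f_eq_id_of_affine_conj L b hL)

end LatentSystem

theorem corollary1 {d D : ℕ} (S : LatentSystem d D)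
    (q : Euc d → ℝ) (hq_meas : Measurable q) (hq_pos : ∀ x, 0 < q x) (hq_one : ∫ x, q x = 1) :
    -- the relation between estimated and true dynamics forces `f = id` if `fhat = id`
    (∀ (L : Euc d ≃ₗ[ℝ] Euc d) (b : Euc d),
      (∀ x, x = L (S.f (L.symm (x - b))) + b) → S.f = id) ∧
    -- for non-trivial dynamics, identifiability fails for every encoder
    (S.f ≠ id → ∀ h : Euc D → Euc d, ¬ S.Identifies h id) ∧
    -- if the model with `fhat = id` attains the global minimum, then the dynamics are trivial
    (∀ (h : Euc D → Euc d) (α : Euc D → ℝ), (∀ x, α (S.g x) = Real.log (q x)) →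
      S.AttainsGlobalMinimum q (contrastiveModel h id α) →
        S.f =ᵐ[volume] id ∧ (Continuous S.f → S.f = id)) ∧
    -- linear dynamics `f x = A x` with `A ≠ 1`
    (∀ A : Matrix (Fin d) (Fin d) ℝ, A ≠ 1 → (∀ x, S.f x = Matrix.toEuclideanLin A x) →
      (∀ h : Euc D → Euc d, ¬ S.Identifies h id) ∧
      ∀ (h : Euc D → Euc d) (α : Euc D → ℝ), (∀ x, α (S.g x) = Real.log (q x)) →
        ¬ S.AttainsGlobalMinimum q (contrastiveModel h id α)) := by
  have hae : ∀ (h : Euc D → Euc d) (α : Euc D → ℝ), (∀ x, α (S.g x) = Real.log (q x)) →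
      S.AttainsGlobalMinimum q (contrastiveModel h id α) →
        S.f =ᵐ[volume] id ∧ (Continuous S.f → S.f = id) := fun h α hα hmin =>
    have hid := LatentSystem.AttainsGlobalMinimum.ae_eq_id hα hmin hq_meas hq_pos hq_one
    ⟨hid, fun hf => (hf.ae_eq_iff_eq volume continuous_id).1 hid⟩
  refine ⟨S.f_eq_id_of_affine_conj, S.not_identifies_id, hae, fun A hA hf => ?_⟩
  have hne : S.f ≠ id := fun hid => hA <| Matrix.toEuclideanLin.injective <| by
    ext1 x
    rw [← hf x, hid]
    simp [Matrix.toLpLin_one]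
  have hcont : Continuous S.f := by
    rw [funext hf]
    exact LinearMap.continuous_of_finiteDimensional _
  exact ⟨S.not_identifies_id hne, fun h α hα hmin => hne ((hae h α hα hmin).2 hcont)⟩
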